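/- Let $M$ be a compact connected smooth manifold without boundary, let $\rho$ be a smooth action of $\mathbb R^k$ on $M$, let $X_1,\dots,X_k$ be the commuting smooth vector fields generating it, i.e. $(X_i f)(x)=\frac{d}{dt}\big|_{t=0} f(\rho(te_i)x)$, and let $L_\rho=\sum_{i=1}^k X_i^2$ be the leafwise Laplacian of $\rho$, acting on $C^\infty(M)$. A distribution on $M$ is a continuous linear functional on $C^\infty(M)$; it is called smooth if it is given by a smooth density on $M$, that is, if in every chart it is integration against a smooth function times Lebesgue measure. The operator $L_\rho$ acts on distributions by $(L_\rho u)(f)=u(L_\rho f)$, and $L_\rho$ is called globally hypoelliptic if every distribution $u$ for which $L_\rho u$ is smooth is itself smooth. If $L_\rho$ is globally hypoelliptic, then $\rho$ is uniquely ergodic (there is exactly one $\rho$-invariant Borel probability measure on $M$) and minimal (every $\rho$-orbit is dense in $M$). -/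

import Mathlib

open scoped Manifold ContDiff Topology UniformConvergence
open MeasureTheory Set

noncomputable section

section Distributions

variable (n : ℕ) (M : Type*) [TopologicalSpace M] [ChartedSpace (EuclideanSpace ℝ (Fin n)) M]

/-- The space `E(M)` of smooth real functions on the manifold `M`. -/
abbrev SmoothFunctions : Type _ := C^∞⟮𝓡 n, M; ℝ⟯

/-- The `C^∞` topology on `E(M)`: uniform convergence, on the compact subsets of the chart domains,
of the partial derivatives of every order of the local representatives. -/
instance smoothFunctionsTopology : TopologicalSpace (SmoothFunctions n M) :=
  ⨅ (c : M) (m : ℕ), TopologicalSpace.induced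
    (fun f : SmoothFunctions n M =>
      UniformOnFun.ofFun
        {K : Set (EuclideanSpace ℝ (Fin n)) |
          IsCompact K ∧ K ⊆ (chartAt (EuclideanSpace ℝ (Fin n)) c).target}
        (iteratedFDeriv ℝ m (f ∘ (chartAt (EuclideanSpace ℝ (Fin n)) c).symm)))
    inferInstance

/-- The space `E'(M)` of distributions on the compact manifold `M`:
continuous linear functionals on `E(M)`. -/
abbrev DistributionOn : Type _ := SmoothFunctions n M →L[ℝ] ℝ

variable {n M}

/-- A distribution is smooth if it is a smooth density, that is, if in every chart it is
integration against a smooth function times Lebesgue measure. -/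
def DistributionOn.IsSmooth (u : DistributionOn n M) : Prop :=
  ∀ c : M, ∃ g : EuclideanSpace ℝ (Fin n) → ℝ,
    ContDiffOn ℝ ∞ g (chartAt (EuclideanSpace ℝ (Fin n)) c).target ∧
    ∀ f : SmoothFunctions n M,
      tsupport f ⊆ (chartAt (EuclideanSpace ℝ (Fin n)) c).source →
        u f = ∫ y in (chartAt (EuclideanSpace ℝ (Fin n)) c).target,
          f ((chartAt (EuclideanSpace ℝ (Fin n)) c).symm y) * g y

/-- An operator `L` on `E(M)` acts on distributions by duality, `u ↦ u ∘ L`. It is globally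
hypoelliptic if every distribution `u` for which `u ∘ L` is a smooth distribution `w` is itself
smooth. -/
def IsGloballyHypoelliptic (L : SmoothFunctions n M →ₗ[ℝ] SmoothFunctions n M) : Prop :=
  ∀ u w : DistributionOn n M, w.IsSmooth → (∀ f : SmoothFunctions n M, u (L f) = w f) → u.IsSmooth

end Distributions

section Actions

variable {k n : ℕ} {M : Type*} [TopologicalSpace M] [ChartedSpace (EuclideanSpace ℝ (Fin n)) M]
  [AddAction (EuclideanSpace ℝ (Fin k)) M]

theorem contMDiff_orbit_pullback [ContMDiffVAdd (𝓡 k) (𝓡 n) ∞ (EuclideanSpace ℝ (Fin k)) M]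
    (i : Fin k) (f : SmoothFunctions n M) :
    ContMDiff ((𝓡 n).prod 𝓘(ℝ, ℝ)) 𝓘(ℝ, ℝ) ∞
      (fun p : M × ℝ => f ((p.2 • EuclideanSpace.single i (1 : ℝ)) +ᵥ p.1)) := by
  have h1 : ContMDiff ((𝓡 n).prod 𝓘(ℝ, ℝ)) (𝓡 k) ∞
      (fun p : M × ℝ => p.2 • (EuclideanSpace.single i (1 : ℝ) : EuclideanSpace ℝ (Fin k))) :=
    contMDiff_snd.smul contMDiff_const
  have h2 : ContMDiff ((𝓡 k).prod (𝓡 n)) (𝓡 n) ∞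
      (fun p : EuclideanSpace ℝ (Fin k) × M => p.1 +ᵥ p.2) :=
    ContMDiffVAdd.contMDiff_vadd
  exact f.contMDiff.comp (h2.comp (h1.prodMk contMDiff_fst))

theorem differentiableAt_orbit_pullback
    [ContMDiffVAdd (𝓡 k) (𝓡 n) ∞ (EuclideanSpace ℝ (Fin k)) M]
    (i : Fin k) (f : SmoothFunctions n M) (x : M) :
    DifferentiableAt ℝ (fun t : ℝ => f ((t • EuclideanSpace.single i (1 : ℝ)) +ᵥ x)) 0 := by
  have h : ContMDiff 𝓘(ℝ, ℝ) 𝓘(ℝ, ℝ) ∞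
      (fun t : ℝ => f ((t • EuclideanSpace.single i (1 : ℝ)) +ᵥ x)) :=
    (contMDiff_orbit_pullback i f).comp (contMDiff_const.prodMk contMDiff_id)
  exact (h.contDiff.differentiable (by simp)).differentiableAt

theorem contMDiff_orbit_deriv [IsManifold (𝓡 n) ∞ M]
    [ContMDiffVAdd (𝓡 k) (𝓡 n) ∞ (EuclideanSpace ℝ (Fin k)) M]
    (i : Fin k) (f : SmoothFunctions n M) :
    ContMDiff (𝓡 n) 𝓘(ℝ, ℝ) ∞
      (fun x : M => deriv (fun t : ℝ => f ((t • EuclideanSpace.single i (1 : ℝ)) +ᵥ x)) 0) := by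
  intro x₀
  have h := ContMDiffAt.mfderiv (I := 𝓘(ℝ, ℝ)) (I' := 𝓘(ℝ, ℝ)) (J := 𝓡 n) (m := ∞) (n := ∞)
    (x₀ := x₀)
    (fun (x : M) (t : ℝ) => f ((t • EuclideanSpace.single i (1 : ℝ)) +ᵥ x)) (fun _ => (0 : ℝ))
    ((contMDiff_orbit_pullback i f) (x₀, 0)) contMDiffAt_const (by simp)
  have h' : ContMDiffAt (𝓡 n) 𝓘(ℝ, ℝ →L[ℝ] ℝ) ∞
      (fun x : M => fderiv ℝ (fun t : ℝ => f ((t • EuclideanSpace.single i (1 : ℝ)) +ᵥ x)) 0) x₀ := by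
    simpa [inTangentCoordinates_model_space, mfderiv_eq_fderiv] using h
  simpa [fderiv_apply_one_eq_deriv] using h'.clm_apply (contMDiffAt_const (c := (1 : ℝ)))

variable (k n M)

/-- The Lie derivative on `E(M)` along the `i`-th generator `X_i` of the action:
`(X_i f)(x)` is the derivative of `f (t e_i · x)` at `t = 0`. -/
def lieDerivativeGenerator [IsManifold (𝓡 n) ∞ M]
    [ContMDiffVAdd (𝓡 k) (𝓡 n) ∞ (EuclideanSpace ℝ (Fin k)) M] (i : Fin k) :
    SmoothFunctions n M →ₗ[ℝ] SmoothFunctions n M where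
  toFun f :=
    ⟨fun x : M => deriv (fun t : ℝ => f ((t • EuclideanSpace.single i (1 : ℝ)) +ᵥ x)) 0,
      contMDiff_orbit_deriv i f⟩
  map_add' f g := by
    ext x
    exact deriv_add (differentiableAt_orbit_pullback i f x) (differentiableAt_orbit_pullback i g x)
  map_smul' a f := by
    ext x
    exact deriv_const_mul a (differentiableAt_orbit_pullback i f x)

/-- The leafwise Laplacian `L = ∑ X_i²` of the action. -/
def leafwiseLaplacian [IsManifold (𝓡 n) ∞ M]
    [ContMDiffVAdd (𝓡 k) (𝓡 n) ∞ (EuclideanSpace ℝ (Fin k)) M] :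
    SmoothFunctions n M →ₗ[ℝ] SmoothFunctions n M :=
  ∑ i : Fin k, lieDerivativeGenerator k n M i ∘ₗ lieDerivativeGenerator k n M i

/-- The action is uniquely ergodic: it has exactly one invariant Borel probability measure. -/
def IsUniquelyErgodicAction (k : ℕ) (M : Type*) [MeasurableSpace M]
    [AddAction (EuclideanSpace ℝ (Fin k)) M] : Prop :=
  ∃! μ : Measure M, IsProbabilityMeasure μ ∧ VAddInvariantMeasure (EuclideanSpace ℝ (Fin k)) M μ

end Actions

end

/-! An invariant measure μ satisfies ∫ X_i f dμ = 0, since t ↦ ∫ f(t e_i · x) dμ is constant. Hence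
μ, as a distribution, is killed by the leafwise Laplacian, and global hypoellipticity forces it to
have a smooth density (`isSmooth_of_vaddInvariantMeasure`). Since ℝ^k is amenable, every orbit
closure carries an invariant probability measure (`exists_vaddInvariant_measure_closure_orbit`).

Minimality: the frontier of an orbit closure is closed, invariant and has empty interior. If
nonempty, it would carry an invariant probability measure whose continuous density vanishes on a
dense open set, which is absurd. So orbit closures are clopen, and M is connected.

Uniqueness: if μ ≠ ν, the truncated differences μ - ν and ν - μ are nonzero, invariant and mutually
singular. Minimality gives both full support, and two continuous densities of full support are
positive together on some open set, contradicting singularity. -/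

/-! ### Invariant measures on orbit closures, and their truncated differences. -/

section InvariantMeasures

open Filter
open scoped ENNReal NNReal BoundedContinuousFunction

/-- A probability measure on a finite-dimensional space with density decaying polynomially:
translates of it are dominated by multiples of it. -/
theorem exists_isProbabilityMeasure_map_add_le (E : Type*) [NormedAddCommGroup E]
    [NormedSpace ℝ E] [FiniteDimensional ℝ E] [MeasurableSpace E] [BorelSpace E] :
    ∃ (P : Measure E) (r : ℝ), IsProbabilityMeasure P ∧
      ∀ s : E, P.map (s + ·) ≤ ENNReal.ofReal ((1 + ‖s‖) ^ r) • P := by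
  let ν : Measure E := Measure.addHaar
  -- Any exponent above the dimension makes the weight integrable.
  let r : ℝ := Module.finrank ℝ E + 1
  let w : E → ℝ≥0∞ := fun t => ENNReal.ofReal ((1 + ‖t‖) ^ (-r))
  have hw : Measurable w := by fun_prop
  have hfin : ∫⁻ t, w t ∂ν ≠ ⊤ :=
    (finite_integral_one_add_norm (lt_add_one _)).ne
  have hpos : ∫⁻ t, w t ∂ν ≠ 0 := by
    rw [← pos_iff_ne_zero, lintegral_pos_iff_support hw]
    have : Function.support w = univ := by
      ext t
      simp only [Function.mem_support, mem_univ, iff_true, w, ne_eq, ENNReal.ofReal_eq_zero, not_le]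
      positivity
    rw [this]
    exact Measure.measure_univ_pos.2 (NeZero.ne ν)
  have hshift : ∀ s t : E, w t ≤ ENNReal.ofReal ((1 + ‖s‖) ^ r) * w (s + t) := by
    intro s t
    rw [← ENNReal.ofReal_mul (by positivity)]
    refine ENNReal.ofReal_le_ofReal ?_
    have h1 : (1 + ‖s + t‖) ^ r ≤ (1 + ‖s‖) ^ r * (1 + ‖t‖) ^ r := by
      rw [← Real.mul_rpow (by positivity) (by positivity)]
      refine Real.rpow_le_rpow (by positivity) ?_ (by positivity)
      nlinarith [norm_add_le s t, norm_nonneg s, norm_nonneg t,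
        mul_nonneg (norm_nonneg s) (norm_nonneg t)]
    rw [Real.rpow_neg (by positivity), Real.rpow_neg (by positivity)]
    rw [inv_le_iff_one_le_mul₀ (by positivity), mul_right_comm, ← div_eq_mul_inv,
      le_div_iff₀ (by positivity), one_mul]
    exact h1
  refine ⟨(∫⁻ t, w t ∂ν)⁻¹ • ν.withDensity w, r, ⟨?_⟩, fun s => ?_⟩
  · simp [ENNReal.inv_mul_cancel hpos hfin]
  · rw [Measure.map_smul, smul_comm]
    suffices h : (ν.withDensity w).map (s + ·) ≤
        ENNReal.ofReal ((1 + ‖s‖) ^ r) • ν.withDensity w by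
      refine Measure.le_iff.2 fun A hA => ?_
      have := Measure.le_iff.1 h A hA
      simp only [Measure.smul_apply, smul_eq_mul] at this ⊢
      gcongr
    refine Measure.le_iff.2 fun A hA => ?_
    have hadd : Measurable (s + · : E → E) := by fun_prop
    rw [Measure.map_apply hadd hA, Measure.smul_apply, smul_eq_mul,
      withDensity_apply _ (hadd hA), withDensity_apply _ hA, ← lintegral_indicator (hadd hA),
      ← lintegral_indicator hA,
      ← lintegral_add_left_eq_self (A.indicator w) s,
      ← lintegral_const_mul' _ _ ENNReal.ofReal_ne_top]
    refine lintegral_mono fun t => ?_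
    by_cases h : s + t ∈ A
    · simpa [indicator, h] using hshift s t
    · simp [indicator, h]

/-- Every orbit closure of a continuous action of a finite-dimensional vector space on a compact
space carries an invariant probability measure. -/
theorem exists_vaddInvariant_measure_closure_orbit (E X : Type*) [NormedAddCommGroup E]
    [NormedSpace ℝ E] [FiniteDimensional ℝ E] [TopologicalSpace X] [CompactSpace X] [T2Space X]
    [HasOuterApproxClosed X] [MeasurableSpace X] [BorelSpace X] [AddAction E X]
    [ContinuousVAdd E X] (x : X) :
    ∃ μ : Measure X, IsProbabilityMeasure μ ∧ VAddInvariantMeasure E X μ ∧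
      μ (closure (AddAction.orbit E x))ᶜ = 0 := by
  borelize E
  obtain ⟨P, r, hP, hPs⟩ := exists_isProbabilityMeasure_map_add_le E
  -- Acting by s after the dilated orbit map is translating E by s/(n+1), which costs a factor (1 +
  -- ‖s‖/(n+1))^r → 1. Limits of the pushforwards of P are therefore invariant.
  let φ : ℕ → E → X := fun n t => ((n + 1 : ℝ) • t) +ᵥ x
  have hφ : ∀ n, Continuous (φ n) := fun n => by dsimp only [φ]; fun_prop
  let μs : ℕ → ProbabilityMeasure X := fun n =>
    ⟨P.map (φ n), Measure.isProbabilityMeasure_map (hφ n).aemeasurable⟩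
  let U : Ultrafilter ℕ := Ultrafilter.of atTop
  have hU : (U : Filter ℕ) ≤ atTop := Ultrafilter.of_le _
  obtain ⟨μ, hμ⟩ : ∃ μ, Tendsto μs U (𝓝 μ) :=
    ⟨(U.map μs).lim, (U.map μs).le_nhds_lim⟩
  have hle : ∀ (s : E) (f : X →ᵇ ℝ≥0),
      ∫⁻ y, f (s +ᵥ y) ∂(μ : Measure X) ≤ ∫⁻ y, f y ∂(μ : Measure X) := by
    intro s f
    have hs : Continuous fun y : X => s +ᵥ y := continuous_const_vadd s
    have h1 := ProbabilityMeasure.tendsto_iff_forall_lintegral_tendsto.1 hμ f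
    have h2 := ProbabilityMeasure.tendsto_iff_forall_lintegral_tendsto.1 hμ
      (f.compContinuous ⟨_, hs⟩)
    have hc : Tendsto
        (fun n : ℕ => ENNReal.ofReal ((1 + ‖s‖ * (1 / ((n : ℝ) + 1))) ^ r)) U (𝓝 1) := by
      refine Tendsto.mono_left ?_ hU
      rw [← ENNReal.ofReal_one]
      refine ENNReal.tendsto_ofReal ?_
      have h0 := (tendsto_one_div_add_atTop_nhds_zero_nat (𝕜 := ℝ)).const_mul ‖s‖
      have h3 := (h0.const_add 1).rpow_const (p := r) (Or.inl (by simp))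
      simpa using h3
    have h4 := ENNReal.Tendsto.mul hc (Or.inl one_ne_zero) h1 (Or.inr ENNReal.one_ne_top)
    rw [one_mul] at h4
    refine le_of_tendsto_of_tendsto' h2 h4 fun n => ?_
    change ∫⁻ y, f (s +ᵥ y) ∂(P.map (φ n)) ≤ _ * ∫⁻ y, f y ∂(P.map (φ n))
    have hn : (n + 1 : ℝ) ≠ 0 := by positivity
    set a : E := (1 / ((n : ℝ) + 1)) • s with ha
    have hna : ‖a‖ = ‖s‖ * (1 / ((n : ℝ) + 1)) := by
      rw [ha, norm_smul, mul_comm, Real.norm_of_nonneg (by positivity)]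
    have hmf : Measurable fun y => (f y : ℝ≥0∞) := by fun_prop
    have hmfs : Measurable fun y => (f (s +ᵥ y) : ℝ≥0∞) := hmf.comp hs.measurable
    rw [lintegral_map hmfs (hφ n).measurable, lintegral_map hmf (hφ n).measurable, ← hna]
    have hk : ∀ t, s +ᵥ φ n t = φ n (a + t) := by
      intro t
      simp only [φ, ha, smul_add, smul_smul, vadd_vadd]
      rw [mul_one_div_cancel hn, one_smul]
    simp only [hk]
    rw [← lintegral_map (f := fun t => (f (φ n t) : ℝ≥0∞)) (μ := P) (hmf.comp (hφ n).measurable)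
      (measurable_const_add a), ← smul_eq_mul, ← lintegral_smul_measure]
    exact lintegral_mono' (hPs a) le_rfl
  refine ⟨μ, inferInstance, ?_, ?_⟩
  · have key : ∀ s : E, (μ : Measure X).map (s +ᵥ ·) = μ := by
      intro s
      have hs : Continuous fun y : X => s +ᵥ y := continuous_const_vadd s
      refine (ext_of_forall_lintegral_eq_of_IsFiniteMeasure fun f => ?_).symm
      rw [lintegral_map (by fun_prop) hs.measurable]
      refine le_antisymm ?_ (hle s f)
      -- The one-sided bound for -s, applied to f(s + ·), is the reverse inequality.
      simpa using hle (-s) (f.compContinuous ⟨_, hs⟩)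
    refine ⟨fun s A hA => ?_⟩
    rw [← Measure.map_apply (continuous_const_vadd s).measurable hA, key]
  · have hcl : IsClosed (closure (AddAction.orbit E x)) := isClosed_closure
    rw [prob_compl_eq_zero_iff hcl.measurableSet]
    refine le_antisymm prob_le_one ?_
    have := ProbabilityMeasure.limsup_measure_closed_le_of_tendsto hμ hcl
    refine le_trans ?_ this
    have h1 : ∀ n, (μs n : Measure X) (closure (AddAction.orbit E x)) = 1 := by
      intro n
      change P.map (φ n) _ = 1
      rw [Measure.map_apply (hφ n).measurable hcl.measurableSet]
      have : φ n ⁻¹' closure (AddAction.orbit E x) = univ :=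
        eq_univ_of_forall fun t => subset_closure ⟨_, rfl⟩
      rw [this, measure_univ]
    simp [h1]

variable {G X : Type*} [AddGroup G] [AddAction G X] [MeasurableSpace X]

/-- The truncated difference of invariant measures is invariant. -/
theorem MeasureTheory.Measure.vaddInvariantMeasure_sub [MeasurableConstVAdd G X] (μ ν : Measure X)
    [IsFiniteMeasure μ] [IsFiniteMeasure ν]
    [VAddInvariantMeasure G X μ] [VAddInvariantMeasure G X ν] :
    VAddInvariantMeasure G X (μ - ν) := by
  -- μ - ν is the least d with μ ≤ d + ν, and its translates satisfy the same inequality.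
  have hle : ∀ g : G, μ - ν ≤ (μ - ν).map (g +ᵥ ·) := by
    intro g
    refine Measure.sub_le_of_le_add ?_
    have h : μ ≤ (μ - ν) + ν := Measure.sub_le_iff_le_add.1 le_rfl
    have h' := Measure.map_mono h (measurable_const_vadd g)
    rwa [Measure.map_add _ _ (measurable_const_vadd g),
      (measurePreserving_vadd g μ).map_eq, (measurePreserving_vadd g ν).map_eq] at h'
  refine ⟨fun g A hA => ?_⟩
  rw [← Measure.map_apply (measurable_const_vadd g) hA]
  refine le_antisymm ?_ (hle g A)
  have h := hle (-g) ((g +ᵥ ·) ⁻¹' A)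
  rw [Measure.map_apply (measurable_const_vadd (-g)) (measurable_const_vadd g hA),
    ← preimage_comp] at h
  rw [Measure.map_apply (measurable_const_vadd g) hA]
  simpa [Function.comp_def] using h

end InvariantMeasures

/-! ### Finite measures as distributions. -/

section MeasuresAsDistributions

variable {n : ℕ} {M : Type*} [TopologicalSpace M] [ChartedSpace (EuclideanSpace ℝ (Fin n)) M]

theorem DistributionOn.isSmooth_zero : (0 : DistributionOn n M).IsSmooth := fun _ =>
  ⟨0, contDiffOn_const, by simp⟩

/-- The `C^∞` topology is finer than the topology of uniform convergence. -/
theorem continuous_smoothFunctions_toContinuousMap [CompactSpace M] :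
    Continuous (fun f : SmoothFunctions n M => (⟨f, f.contMDiff.continuous⟩ : C(M, ℝ))) := by
  rw [continuous_iff_continuousAt]
  intro f₀
  refine ContinuousMap.tendsto_iff_tendstoLocallyUniformly.2 fun u hu x => ?_
  set e := chartAt (EuclideanSpace ℝ (Fin n)) x
  have hx : x ∈ e.source := mem_chart_source _ x
  obtain ⟨K, hKx, hKe, hK⟩ : ∃ K ∈ 𝓝 (e x), K ⊆ e.target ∧ IsCompact K :=
    local_compact_nhds (e.open_target.mem_nhds (e.map_source hx))
  refine ⟨e.source ∩ e ⁻¹' K, ?_, ?_⟩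
  · exact Filter.inter_mem (e.open_source.mem_nhds hx) (e.continuousAt hx hKx)
  let 𝔖 : Set (Set (EuclideanSpace ℝ (Fin n))) := {K | IsCompact K ∧ K ⊆ e.target}
  let F : SmoothFunctions n M → UniformOnFun (EuclideanSpace ℝ (Fin n))
      (ContinuousMultilinearMap ℝ (fun _ : Fin 0 => EuclideanSpace ℝ (Fin n)) ℝ) 𝔖 :=
    fun f => UniformOnFun.ofFun 𝔖 (iteratedFDeriv ℝ 0 (f ∘ e.symm))
  have hF : Continuous F := by
    refine continuous_iff_le_induced.2 ?_
    -- Only the derivative of order 0 in the chart at x is needed.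
    exact (iInf_le _ x).trans (iInf_le _ 0)
  have h1 := UniformOnFun.tendsto_iff_tendstoUniformlyOn.1 (hF.tendsto f₀) K ⟨hK, hKe⟩
  have h2 := (continuousMultilinearCurryFin0 ℝ (EuclideanSpace ℝ (Fin n)) ℝ).isometry.uniformContinuous
    |>.comp_tendstoUniformlyOn h1
  filter_upwards [h2 u hu] with f hf y hy
  have := hf (e y) hy.2
  simpa [F, e.left_inv hy.1] using this

variable [CompactSpace M] [MeasurableSpace M] [BorelSpace M]

theorem continuous_integral_continuousMap {X : Type*} [TopologicalSpace X] [CompactSpace X]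
    [MeasurableSpace X] [BorelSpace X] (μ : Measure X) [IsFiniteMeasure μ] :
    Continuous fun f : C(X, ℝ) => ∫ x, f x ∂μ := by
  have h := (continuous_integral (μ := μ) (G := ℝ)).comp (ContinuousMap.toLp 1 μ ℝ).continuous
  exact h.congr fun f => integral_congr_ae (ContinuousMap.coeFn_toLp μ f)

variable (n) in
/-- A finite measure on a compact manifold is a distribution. -/
noncomputable def MeasureTheory.Measure.toDistributionOn (μ : Measure M) [IsFiniteMeasure μ] : DistributionOn n M where
  toFun f := ∫ x, f x ∂μ
  map_add' f g := integral_add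
    (f.contMDiff.continuous.integrable_of_hasCompactSupport (.of_compactSpace _))
    (g.contMDiff.continuous.integrable_of_hasCompactSupport (.of_compactSpace _))
  map_smul' a _ := integral_const_mul a _
  cont := (continuous_integral_continuousMap μ).comp continuous_smoothFunctions_toContinuousMap

end MeasuresAsDistributions

/-! ### Invariant measures are annihilated by the leafwise Laplacian. -/

section Generators

variable {k n : ℕ} {M : Type*} [TopologicalSpace M] [ChartedSpace (EuclideanSpace ℝ (Fin n)) M]
  [AddAction (EuclideanSpace ℝ (Fin k)) M] [IsManifold (𝓡 n) ∞ M]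
  [ContMDiffVAdd (𝓡 k) (𝓡 n) ∞ (EuclideanSpace ℝ (Fin k)) M]

theorem hasDerivAt_orbit (i : Fin k) (f : SmoothFunctions n M) (x : M) (t : ℝ) :
    HasDerivAt (fun t : ℝ => f ((t • EuclideanSpace.single i (1 : ℝ)) +ᵥ x))
      (lieDerivativeGenerator k n M i f ((t • EuclideanSpace.single i (1 : ℝ)) +ᵥ x)) t := by
  have h := (differentiableAt_orbit_pullback i f
    ((t • EuclideanSpace.single i (1 : ℝ)) +ᵥ x)).hasDerivAt
  have h2 : HasDerivAt _ (lieDerivativeGenerator k n M i f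
      ((t • EuclideanSpace.single i (1 : ℝ)) +ᵥ x)) t :=
    HasDerivAt.comp_sub_const t t (f := fun s : ℝ => f ((s • EuclideanSpace.single i (1 : ℝ)) +ᵥ
      ((t • EuclideanSpace.single i (1 : ℝ) : EuclideanSpace ℝ (Fin k)) +ᵥ x)))
      (by rw [sub_self]; exact h)
  simpa only [vadd_vadd, ← add_smul, sub_add_cancel] using h2

variable [CompactSpace M] [MeasurableSpace M] [BorelSpace M]

/-- The derivative of a function along an invariant measure integrates to zero. -/
theorem integral_lieDerivativeGenerator_eq_zero (μ : Measure M) [IsFiniteMeasure μ]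
    [VAddInvariantMeasure (EuclideanSpace ℝ (Fin k)) M μ] (i : Fin k) (f : SmoothFunctions n M) :
    ∫ x, lieDerivativeGenerator k n M i f x ∂μ = 0 := by
  have : ContinuousVAdd (EuclideanSpace ℝ (Fin k)) M :=
    ContMDiffVAdd.continuousVAdd (I := 𝓡 k) (I' := 𝓡 n) ∞
  let e : EuclideanSpace ℝ (Fin k) := EuclideanSpace.single i 1
  have hc : ∀ (g : SmoothFunctions n M) (t : ℝ), Continuous fun x => g ((t • e) +ᵥ x) :=
    fun g t => g.contMDiff.continuous.comp (continuous_const_vadd _)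
  have hint : ∀ (g : SmoothFunctions n M) (t : ℝ), Integrable (fun x => g ((t • e) +ᵥ x)) μ :=
    fun g t => (hc g t).integrable_of_hasCompactSupport (.of_compactSpace _)
  obtain ⟨C, hC⟩ := (isCompact_range
    (lieDerivativeGenerator k n M i f).contMDiff.continuous).isBounded.exists_norm_le
  -- Differentiation under the integral; compactness bounds X_i f along all orbits.
  have h := (hasDerivAt_integral_of_dominated_loc_of_deriv_le (μ := μ) (x₀ := (0 : ℝ))
    (F := fun t x => f ((t • e) +ᵥ x)) (s := univ) (bound := fun _ => C)
    (F' := fun t x => lieDerivativeGenerator k n M i f ((t • e) +ᵥ x)) Filter.univ_mem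
    (.of_forall fun t => (hint f t).aestronglyMeasurable) (hint f 0)
    (hint _ 0).aestronglyMeasurable
    (.of_forall fun x t _ => hC _ (mem_range_self _)) (integrable_const C)
    (.of_forall fun x t _ => hasDerivAt_orbit i f x t)).2
  have hconst : (fun t : ℝ => ∫ x, f ((t • e) +ᵥ x) ∂μ) = fun _ => ∫ x, f x ∂μ := by
    ext t
    exact integral_vadd_eq_self (μ := μ) (fun x => f x)
  rw [hconst] at h
  simpa using h.unique (hasDerivAt_const _ _)

/-- If the leafwise Laplacian is globally hypoelliptic, invariant measures are smooth. -/
theorem isSmooth_of_vaddInvariantMeasure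
    (hGH : IsGloballyHypoelliptic (leafwiseLaplacian k n M)) (μ : Measure M) [IsFiniteMeasure μ]
    [VAddInvariantMeasure (EuclideanSpace ℝ (Fin k)) M μ] :
    (μ.toDistributionOn n).IsSmooth := by
  refine hGH _ 0 DistributionOn.isSmooth_zero fun f => ?_
  simp only [leafwiseLaplacian, LinearMap.sum_apply, map_sum]
  exact Finset.sum_eq_zero fun i _ => integral_lieDerivativeGenerator_eq_zero μ i _

end Generators

/-! ### From smooth distributions to densities on compact sets. -/

section ChartDensities

variable {n : ℕ} {M : Type*} [TopologicalSpace M] [ChartedSpace (EuclideanSpace ℝ (Fin n)) M]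

/-- The set function `K ↦ μ K` on compact subsets of the chart at `c` has density `g`. -/
def MeasureTheory.Measure.HasChartDensity [MeasurableSpace M] (μ : Measure M) (c : M)
    (g : EuclideanSpace ℝ (Fin n) → ℝ) : Prop :=
  ContinuousOn g (chartAt (EuclideanSpace ℝ (Fin n)) c).target ∧
  ∀ K ⊆ (chartAt (EuclideanSpace ℝ (Fin n)) c).target, IsCompact K →
    μ.real ((chartAt (EuclideanSpace ℝ (Fin n)) c).symm '' K) = ∫ y in K, g y

variable [IsManifold (𝓡 n) ∞ M] [T2Space M] [CompactSpace M] [MeasurableSpace M] [BorelSpace M]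

/-- Powers of a smooth bump equal to 1 exactly on a compact set converge to its indicator, so
dominated convergence passes from test functions to compact sets. -/
theorem DistributionOn.IsSmooth.exists_hasChartDensity {μ : Measure M} [IsFiniteMeasure μ]
    (h : (μ.toDistributionOn n).IsSmooth) (c : M) : ∃ g, μ.HasChartDensity (n := n) c g := by
  obtain ⟨g, hg, hgf⟩ := h c
  refine ⟨g, hg.continuousOn, fun K hKt hK => ?_⟩
  set e := chartAt (EuclideanSpace ℝ (Fin n)) c
  have hKM : IsCompact (e.symm '' K) := hK.image_of_continuousOn (e.continuousOn_symm.mono hKt)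
  have hKs : e.symm '' K ⊆ e.source := by
    rintro _ ⟨y, hy, rfl⟩
    exact e.map_target (hKt hy)
  obtain ⟨V, hVo, hKV, hVs, -⟩ := exists_open_between_and_isCompact_closure hKM e.open_source hKs
  obtain ⟨f, hf, hf01, hfV, hf1⟩ := exists_contMDiff_support_eq_eq_one_iff (n := ⊤) (𝓡 n) hVo
    hKM.isClosed hKV
  -- The exponent j + 1 keeps the support in V already at j = 0.
  let F : ℕ → SmoothFunctions n M := fun j => ⟨fun x => f x ^ (j + 1), hf.pow (j + 1)⟩
  have hf0 : ∀ x, 0 ≤ f x := fun x => (hf01 (mem_range_self x)).1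
  have hfle : ∀ x, f x ≤ 1 := fun x => (hf01 (mem_range_self x)).2
  have hF01 : ∀ j x, ‖F j x‖ ≤ 1 := fun j x => by
    change ‖f x ^ (j + 1)‖ ≤ 1
    rw [Real.norm_of_nonneg (pow_nonneg (hf0 x) _)]
    exact pow_le_one₀ (hf0 x) (hfle x)
  have hFsupp : ∀ j, tsupport (F j) ⊆ closure V := fun j => by
    refine closure_mono fun x hx => ?_
    rw [← hfV]
    intro h0
    exact hx (by simp [F, h0])
  have hlim : ∀ x, Filter.Tendsto (fun j => F j x) Filter.atTop
      (𝓝 ((e.symm '' K).indicator 1 x)) := by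
    intro x
    by_cases hx : x ∈ e.symm '' K
    · have : f x = 1 := (hf1 x).1 hx
      simp [F, this, indicator_of_mem hx]
    · have hlt : f x < 1 := lt_of_le_of_ne (hfle x) fun h1 => hx ((hf1 x).2 h1)
      rw [indicator_of_notMem hx]
      exact (tendsto_pow_atTop_nhds_zero_of_lt_one (hf0 x) hlt).comp (Filter.tendsto_add_atTop_nat 1)
  have h1 : Filter.Tendsto (fun j => ∫ x, F j x ∂μ) Filter.atTop (𝓝 (μ.real (e.symm '' K))) := by
    rw [← integral_indicator_one hKM.measurableSet]
    exact tendsto_integral_of_dominated_convergence (fun _ => 1)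
      (fun j => (F j).contMDiff.continuous.aestronglyMeasurable) (integrable_const 1)
      (fun j => .of_forall (hF01 j)) (.of_forall hlim)
  set Q := e '' closure V
  have hQ : IsCompact Q := isClosed_closure.isCompact.image_of_continuousOn
    (e.continuousOn.mono hVs)
  have hQt : Q ⊆ e.target := by
    rintro _ ⟨x, hx, rfl⟩
    exact e.map_source (hVs hx)
  have hFQ : ∀ j, ∀ y ∈ e.target, y ∉ Q → F j (e.symm y) = 0 := fun j y hy hyQ => by
    by_contra h0
    exact hyQ ⟨e.symm y, hFsupp j (subset_tsupport _ h0), e.right_inv hy⟩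
  have h2 : Filter.Tendsto (fun j => ∫ y in e.target, F j (e.symm y) * g y) Filter.atTop
      (𝓝 (∫ y in K, g y)) := by
    have hKind : ∫ y in K, g y = ∫ y in e.target, (e.symm '' K).indicator 1 (e.symm y) * g y := by
      rw [← inter_eq_right.2 hKt, ← setIntegral_indicator hK.measurableSet, inter_eq_right.2 hKt]
      refine setIntegral_congr_fun e.open_target.measurableSet fun y hy => ?_
      have hiff : e.symm y ∈ e.symm '' K ↔ y ∈ K :=
        ⟨fun ⟨z, hz, hzy⟩ => e.symm.injOn (hKt hz) hy hzy ▸ hz, mem_image_of_mem _⟩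
      by_cases hyK : y ∈ K
      · simp [indicator_of_mem hyK, indicator_of_mem (hiff.2 hyK)]
      · simp [indicator_of_notMem hyK, indicator_of_notMem (mt hiff.1 hyK)]
    rw [hKind]
    -- g need not be integrable on the whole chart target, so the bound is cut off to the compact
    -- set Q.
    refine tendsto_integral_of_dominated_convergence (Q.indicator fun y => ‖g y‖) (fun j => ?_) ?_
      (fun j => ?_) ?_
    · refine ContinuousOn.aestronglyMeasurable ?_ e.open_target.measurableSet
      exact ((F j).contMDiff.continuous.comp_continuousOn e.continuousOn_symm).mul hg.continuousOn
    · refine Integrable.integrableOn ?_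
      rw [integrable_indicator_iff hQ.measurableSet]
      exact ((hg.continuousOn.mono hQt).integrableOn_compact hQ).norm
    · refine (ae_restrict_iff' e.open_target.measurableSet).2 (.of_forall fun y hy => ?_)
      by_cases hyQ : y ∈ Q
      · rw [indicator_of_mem hyQ, norm_mul]
        exact mul_le_of_le_one_left (norm_nonneg _) (hF01 j _)
      · rw [indicator_of_notMem hyQ, hFQ j y hy hyQ]
        simp
    · exact .of_forall fun y => (hlim _).mul_const _
  exact tendsto_nhds_unique h1 (h2.congr fun j => (hgf (F j) ((hFsupp j).trans hVs)).symm)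

end ChartDensities

/-- A continuous density which integrates to zero over all compact subsets of a dense open set
vanishes. -/
theorem eqOn_zero_of_setIntegral_compact_eq_zero {E : Type*} [NormedAddCommGroup E]
    [NormedSpace ℝ E] [FiniteDimensional ℝ E] [MeasurableSpace E] [BorelSpace E]
    (ν : Measure E) [ν.IsOpenPosMeasure] [IsFiniteMeasureOnCompacts ν] {V : Set E} (hV : IsOpen V)
    {g : E → ℝ} (hg : ContinuousOn g V) (h : ∀ K ⊆ V, IsCompact K → ∫ y in K, g y ∂ν = 0) :
    EqOn g 0 V := by
  wlog hpos : ∃ y ∈ V, 0 < g y generalizing g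
  · intro y hy
    by_contra hne
    rcases lt_or_gt_of_ne hne with hlt | hgt
    · have := this (g := -g) hg.neg (fun K hK hKc => by simp [integral_neg, h K hK hKc])
        ⟨y, hy, by simpa using hlt⟩ hy
      simp at this
      exact hne this
    · exact hpos ⟨y, hy, hgt⟩
  exfalso
  obtain ⟨y, hy, hgy⟩ := hpos
  have hopen : {z ∈ V | g y / 2 < g z} ∈ 𝓝 y :=
    Filter.inter_mem (hV.mem_nhds hy)
      ((hg.continuousAt (hV.mem_nhds hy)).eventually (lt_mem_nhds (half_lt_self hgy)))
  obtain ⟨K, hKy, hKV, hK⟩ := local_compact_nhds hopen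
  have hle : ∫ _ in K, g y / 2 ∂ν ≤ ∫ z in K, g z ∂ν :=
    setIntegral_mono_on (integrableOn_const hK.measure_lt_top.ne)
      ((hg.mono fun z hz => (hKV hz).1).integrableOn_compact hK) hK.measurableSet
      fun z hz => (hKV hz).2.le
  rw [h K (fun z hz => (hKV hz).1) hK, setIntegral_const, smul_eq_mul] at hle
  have : 0 < ν.real K :=
    ENNReal.toReal_pos (Measure.measure_pos_of_mem_nhds ν hKy).ne' hK.measure_lt_top.ne
  nlinarith [mul_pos this (half_pos hgy)]

/-! ### Rigidity of measures with continuous densities. -/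

section Singularity

variable {n : ℕ} {M : Type*} [TopologicalSpace M] [ChartedSpace (EuclideanSpace ℝ (Fin n)) M]
  [MeasurableSpace M] {μ ν : Measure M} {c : M} {g h : EuclideanSpace ℝ (Fin n) → ℝ}

/-- A measure with continuous chart densities that is concentrated on a closed set with empty
interior vanishes. -/
theorem eq_zero_of_hasChartDensity_of_interior_eq_empty [CompactSpace M] [IsFiniteMeasure μ]
    (hμ : ∀ c, ∃ g, μ.HasChartDensity (n := n) c g) {N : Set M} (hN : IsClosed N)
    (hint : interior N = ∅) (hμN : μ Nᶜ = 0) : μ = 0 := by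
  rw [← Measure.measure_univ_eq_zero]
  -- On a compact space it suffices that each point has a null neighbourhood, so one chart is
  -- enough.
  refine isCompact_univ.measure_zero_of_nhdsWithin fun c _ => ?_
  obtain ⟨g, hg, hgK⟩ := hμ c
  set e := chartAt (EuclideanSpace ℝ (Fin n)) c
  have hV : IsOpen (e.target ∩ e.symm ⁻¹' Nᶜ) :=
    e.isOpen_inter_preimage_symm hN.isOpen_compl
  have hgV : EqOn g 0 (e.target ∩ e.symm ⁻¹' Nᶜ) := by
    refine eqOn_zero_of_setIntegral_compact_eq_zero volume hV (hg.mono inter_subset_left)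
      fun K hK hKc => ?_
    rw [← hgK K (fun y hy => (hK hy).1) hKc, measureReal_def,
      measure_mono_null (image_subset_iff.2 fun y hy => (hK hy).2) hμN, ENNReal.toReal_zero]
  have hdense : e.target ⊆ closure (e.target ∩ e.symm ⁻¹' Nᶜ) := by
    intro y hy
    rw [mem_closure_iff]
    intro o ho hyo
    have hopen : IsOpen (e.source ∩ e ⁻¹' o) := e.isOpen_inter_preimage ho
    obtain ⟨x, hx, hxN⟩ := (interior_eq_empty_iff_dense_compl.1 hint).inter_open_nonempty _ hopen
      ⟨e.symm y, e.map_target hy, by simpa [e.right_inv hy] using hyo⟩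
    exact ⟨e x, hx.2, e.map_source hx.1, by simpa [e.left_inv hx.1] using hxN⟩
  have hg0 : EqOn g 0 e.target :=
    hgV.of_subset_closure hg continuousOn_const inter_subset_left hdense
  have hc : c ∈ e.source := mem_chart_source _ c
  obtain ⟨K, hKc, hKe, hK⟩ : ∃ K ∈ 𝓝 (e c), K ⊆ e.target ∧ IsCompact K :=
    local_compact_nhds (e.open_target.mem_nhds (e.map_source hc))
  refine ⟨e.symm '' K, ?_, ?_⟩
  · rw [nhdsWithin_univ]
    simpa [e.left_inv hc] using e.symm.image_mem_nhds (e.map_source hc) hKc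
  · have := hgK K hKe hK
    rw [setIntegral_congr_fun hK.measurableSet (hg0.mono hKe)] at this
    simpa [measureReal_eq_zero_iff] using this

theorem MeasureTheory.Measure.HasChartDensity.exists_pos [IsFiniteMeasure μ] [μ.IsOpenPosMeasure]
    (hμ : μ.HasChartDensity c g) {V : Set (EuclideanSpace ℝ (Fin n))} (hV : IsOpen V)
    (hVt : V ⊆ (chartAt (EuclideanSpace ℝ (Fin n)) c).target) (hne : V.Nonempty) :
    ∃ y ∈ V, 0 < g y := by
  by_contra! hle
  obtain ⟨y, hy⟩ := hne
  obtain ⟨K, hKy, hKV, hK⟩ := local_compact_nhds (hV.mem_nhds hy)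
  have h := hμ.2 K (hKV.trans hVt) hK
  have h1 : ∫ z in K, g z ≤ 0 := setIntegral_nonpos hK.measurableSet fun z hz => hle z (hKV hz)
  have h2 := Measure.measure_pos_of_mem_nhds μ
    ((chartAt (EuclideanSpace ℝ (Fin n)) c).symm.image_mem_nhds (hVt hy) hKy)
  have h3 := ENNReal.toReal_pos h2.ne' (measure_ne_top μ _)
  rw [← h] at h1
  exact absurd h3 h1.not_gt

variable [BorelSpace M]

/-- Where the density is positive, Lebesgue measure is absolutely continuous with respect to μ;
inner regularity reduces this to compact sets. -/
theorem MeasureTheory.Measure.HasChartDensity.volume_eq_zero [IsFiniteMeasure μ]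
    (hμ : μ.HasChartDensity c g) {V : Set (EuclideanSpace ℝ (Fin n))} (hV : IsOpen V)
    (hVt : V ⊆ (chartAt (EuclideanSpace ℝ (Fin n)) c).target) (hpos : ∀ y ∈ V, 0 < g y)
    {S : Set M} (hS : MeasurableSet S) (hμS : μ S = 0) :
    volume (V ∩ (chartAt (EuclideanSpace ℝ (Fin n)) c).symm ⁻¹' S) = 0 := by
  set e := chartAt (EuclideanSpace ℝ (Fin n)) c
  have hmeas : MeasurableSet (V ∩ e.symm ⁻¹' S) := by
    have h := (e.continuousOn_symm.mono hVt).domRestrict.measurable hS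
    rw [← Subtype.image_preimage_coe]
    exact hV.measurableSet.subtype_image h
  by_contra hne
  obtain ⟨K, hKs, hK, hK0⟩ := hmeas.exists_lt_isCompact (pos_iff_ne_zero.2 hne)
  have hKV : K ⊆ V := fun y hy => (hKs hy).1
  have h := hμ.2 K (hKV.trans hVt) hK
  rw [measureReal_def, measure_mono_null (image_subset_iff.2 fun y hy => (hKs hy).2) hμS,
    ENNReal.toReal_zero] at h
  have hi : 0 < ∫ y in K, g y := by
    refine (setIntegral_pos_iff_support_of_nonneg_ae ?_ ?_).2 ?_
    · exact (ae_restrict_iff' hK.measurableSet).2 (.of_forall fun y hy => (hpos y (hKV hy)).le)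
    · exact (hμ.1.mono (hKV.trans hVt)).integrableOn_compact hK
    · have hsupp : K ⊆ Function.support g := fun y hy => (hpos y (hKV hy)).ne'
      rwa [inter_eq_right.2 hsupp]
  exact hi.ne h

/-- Measures with continuous chart densities and full support are not mutually singular. -/
theorem not_mutuallySingular_of_hasChartDensity [IsFiniteMeasure μ] [IsFiniteMeasure ν]
    [μ.IsOpenPosMeasure] [ν.IsOpenPosMeasure] (hμ : μ.HasChartDensity c g)
    (hν : ν.HasChartDensity c h) : ¬ μ ⟂ₘ ν := by
  rintro ⟨S, hS, hμS, hνS⟩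
  set e := chartAt (EuclideanSpace ℝ (Fin n)) c
  have hV : IsOpen (e.target ∩ g ⁻¹' Ioi 0) := hμ.1.isOpen_inter_preimage e.open_target isOpen_Ioi
  have hW : IsOpen (e.target ∩ h ⁻¹' Ioi 0) := hν.1.isOpen_inter_preimage e.open_target isOpen_Ioi
  obtain ⟨y, hy, hgy⟩ := hμ.exists_pos e.open_target subset_rfl
    ⟨e c, e.map_source (mem_chart_source _ c)⟩
  -- Full support of ν, used inside V, yields a point where both densities are positive.
  obtain ⟨z, hz, hhz⟩ := hν.exists_pos hV inter_subset_left ⟨y, hy, hgy⟩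
  have h1 := hμ.volume_eq_zero hV inter_subset_left (fun _ hx => hx.2) hS hμS
  have h2 := hν.volume_eq_zero hW inter_subset_left (fun _ hx => hx.2) hS.compl hνS
  have h3 := (hV.inter hW).measure_pos volume ⟨z, hz, hz.1, hhz⟩
  refine h3.ne' (measure_mono_null (fun x hx => ?_) (measure_union_null h1 h2))
  by_cases hxS : e.symm x ∈ S
  · exact Or.inl ⟨hx.1, hxS⟩
  · exact Or.inr ⟨hx.2, hxS⟩

end Singularity

/-! ### Minimality and unique ergodicity. -/

section Main

variable {k n : ℕ} {M : Type*} [TopologicalSpace M]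
  [ChartedSpace (EuclideanSpace ℝ (Fin n)) M] [IsManifold (𝓡 n) ∞ M]
  [T2Space M] [CompactSpace M]
  [AddAction (EuclideanSpace ℝ (Fin k)) M]
  [ContMDiffVAdd (𝓡 k) (𝓡 n) ∞ (EuclideanSpace ℝ (Fin k)) M]

/-- An action with globally hypoelliptic leafwise Laplacian is minimal. -/
theorem isMinimal_of_isGloballyHypoelliptic [ConnectedSpace M] [MeasurableSpace M] [BorelSpace M]
    (hGH : IsGloballyHypoelliptic (leafwiseLaplacian k n M)) :
    AddAction.IsMinimal (EuclideanSpace ℝ (Fin k)) M := by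
  have : ContinuousVAdd (EuclideanSpace ℝ (Fin k)) M :=
    ContMDiffVAdd.continuousVAdd (I := 𝓡 k) (I' := 𝓡 n) ∞
  have : TopologicalSpace.MetrizableSpace M := Manifold.metrizableSpace (𝓡 n) M
  refine ⟨fun x => ?_⟩
  set N := closure (AddAction.orbit (EuclideanSpace ℝ (Fin k)) x)
  have hN : IsClosed N := isClosed_closure
  have hNinv : ∀ g : EuclideanSpace ℝ (Fin k), (g +ᵥ ·) '' N = N := by
    intro g
    have h := (Homeomorph.vadd g).image_closure (AddAction.orbit (EuclideanSpace ℝ (Fin k)) x)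
    have h' : (g +ᵥ ·) '' AddAction.orbit (EuclideanSpace ℝ (Fin k)) x =
        AddAction.orbit (EuclideanSpace ℝ (Fin k)) x := AddAction.vadd_orbit g x
    exact h.trans (congrArg closure h')
  have hfr : frontier N = ∅ := by
    by_contra hne
    obtain ⟨y, hy⟩ := nonempty_iff_ne_empty.2 hne
    obtain ⟨μ, hμp, hμi, hμ0⟩ :=
      exists_vaddInvariant_measure_closure_orbit (EuclideanSpace ℝ (Fin k)) M y
    have hsub : closure (AddAction.orbit (EuclideanSpace ℝ (Fin k)) y) ⊆ frontier N := by
      refine closure_minimal ?_ isClosed_frontier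
      rintro _ ⟨g, rfl⟩
      have h := (Homeomorph.vadd g).image_frontier N
      have h' : Homeomorph.vadd g '' N = N := hNinv g
      rw [h'] at h
      exact h ▸ mem_image_of_mem _ hy
    have := eq_zero_of_hasChartDensity_of_interior_eq_empty (n := n)
      (fun c => (isSmooth_of_vaddInvariantMeasure hGH μ).exists_hasChartDensity c)
      isClosed_frontier (interior_frontier hN)
      (measure_mono_null (compl_subset_compl.2 hsub) hμ0)
    exact IsProbabilityMeasure.ne_zero μ this
  exact dense_iff_closure_eq.2 ((isClopen_iff_frontier_eq_empty.2 hfr).eq_univ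
    ⟨x, subset_closure (AddAction.mem_orbit_self x)⟩)

/-- An action with globally hypoelliptic leafwise Laplacian has at most one invariant probability
measure. -/
theorem eq_of_isGloballyHypoelliptic [ConnectedSpace M] [MeasurableSpace M] [BorelSpace M]
    (hGH : IsGloballyHypoelliptic (leafwiseLaplacian k n M)) (μ ν : Measure M)
    [IsProbabilityMeasure μ] [IsProbabilityMeasure ν]
    [VAddInvariantMeasure (EuclideanSpace ℝ (Fin k)) M μ]
    [VAddInvariantMeasure (EuclideanSpace ℝ (Fin k)) M ν] : μ = ν := by
  have : ContinuousVAdd (EuclideanSpace ℝ (Fin k)) M :=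
    ContMDiffVAdd.continuousVAdd (I := 𝓡 k) (I' := 𝓡 n) ∞
  have : TopologicalSpace.MetrizableSpace M := Manifold.metrizableSpace (𝓡 n) M
  have := isMinimal_of_isGloballyHypoelliptic hGH
  -- A vanishing truncated difference means ρ ≤ σ, and equal total mass forces equality.
  have hzero : ∀ (ρ σ : Measure M) [IsProbabilityMeasure ρ] [IsProbabilityMeasure σ],
      ρ - σ = 0 → ρ = σ := by
    intro ρ σ _ _ h
    have hle : ρ ≤ 0 + σ := Measure.sub_le_iff_le_add.1 h.le
    rw [zero_add] at hle
    exact Measure.eq_of_le_of_measure_univ_eq hle (by simp)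
  by_contra hne
  have hpos : ∀ (ρ σ : Measure M) [IsProbabilityMeasure ρ] [IsProbabilityMeasure σ]
      [VAddInvariantMeasure (EuclideanSpace ℝ (Fin k)) M ρ]
      [VAddInvariantMeasure (EuclideanSpace ℝ (Fin k)) M σ], ρ ≠ σ →
      (ρ - σ).IsOpenPosMeasure ∧ ∀ c, ∃ g, (ρ - σ).HasChartDensity (n := n) c g := by
    intro ρ σ _ _ _ _ hρσ
    have := Measure.vaddInvariantMeasure_sub (G := EuclideanSpace ℝ (Fin k)) ρ σ
    refine ⟨⟨fun U hU hUn => ?_⟩, fun c =>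
      (isSmooth_of_vaddInvariantMeasure hGH (ρ - σ)).exists_hasChartDensity c⟩
    -- By minimality the translates of U cover M, so a nonzero invariant measure charges U.
    exact (measure_isOpen_pos_of_vaddInvariant_of_ne_zero (EuclideanSpace ℝ (Fin k))
      (mt (hzero ρ σ) hρσ) hU hUn).ne'
  obtain ⟨h1, h2⟩ := hpos μ ν hne
  obtain ⟨h3, h4⟩ := hpos ν μ (Ne.symm hne)
  obtain ⟨c⟩ := (inferInstance : Nonempty M)
  obtain ⟨g, hg⟩ := h2 c
  obtain ⟨h, hh⟩ := h4 c
  exact not_mutuallySingular_of_hasChartDensity hg hh Measure.mutually_singular_measure_sub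

end Main

theorem corollary2p2 (k n : ℕ) (M : Type*) [TopologicalSpace M]
    [ChartedSpace (EuclideanSpace ℝ (Fin n)) M] [IsManifold (𝓡 n) ∞ M]
    [T2Space M] [CompactSpace M] [ConnectedSpace M]
    [MeasurableSpace M] [BorelSpace M]
    [AddAction (EuclideanSpace ℝ (Fin k)) M]
    [ContMDiffVAdd (𝓡 k) (𝓡 n) ∞ (EuclideanSpace ℝ (Fin k)) M]
    (hGH : IsGloballyHypoelliptic (leafwiseLaplacian k n M)) :
    IsUniquelyErgodicAction k M ∧ AddAction.IsMinimal (EuclideanSpace ℝ (Fin k)) M := by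
  have : ContinuousVAdd (EuclideanSpace ℝ (Fin k)) M :=
    ContMDiffVAdd.continuousVAdd (I := 𝓡 k) (I' := 𝓡 n) ∞
  have : TopologicalSpace.MetrizableSpace M := Manifold.metrizableSpace (𝓡 n) M
  refine ⟨?_, isMinimal_of_isGloballyHypoelliptic hGH⟩
  obtain ⟨x⟩ := (inferInstance : Nonempty M)
  obtain ⟨μ, hμp, hμi, -⟩ :=
    exists_vaddInvariant_measure_closure_orbit (EuclideanSpace ℝ (Fin k)) M x
  refine ⟨μ, ⟨hμp, hμi⟩, fun ν ⟨hνp, hνi⟩ => ?_⟩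
  exact eq_of_isGloballyHypoelliptic hGH ν μ
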